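/- Let $\Gamma\cong\mathbb{Z}^k$ with $0<k\le d$, and let $L:\Gamma\to\mathbb{R}^d$ be a nonsingular homomorphism, i.e. $L(\Gamma)$ spans a $k$-dimensional linear subspace. A $\Gamma$-labelled graph $(G,\psi)$ is a finite directed multigraph $G$ with a map $\psi:E(G)\to\Gamma$, without loops and without two parallel edges that have the same label when oriented in the same direction (reversing an edge inverts its label). Its covering $\tilde G$ has vertices $\gamma v$ ($\gamma\in\Gamma$, $v\in V(G)$) and, for every edge $e$ from $u$ to $w$ and every $\gamma\in\Gamma$, an edge joining $\gamma u$ and $\psi(e)\gamma w$. For $p:V(G)\to\mathbb{R}^d$ put $\tilde p(\gamma v)=p(v)+L(\gamma)$. The framework $(G,\psi,p)$ is generic (with respect to $L$) if the $d|V(G)|$ coordinates of $p$ are algebraically independent over the field $\mathbb{Q}(L)$ generated over $\mathbb{Q}$ by the coordinates of the vectors $L(\gamma)$, $\gamma\in\Gamma$; for rational $L$ this is algebraic independence over $\mathbb{Q}$. Let $f_{G,L}(p)=\big(\|p(u)-(p(w)+L(\psi(e)))\|^2\big)_{e=uw\in E(G)}$ and $f_{V(G),L}(p)=\big(\|p(u)-(p(w)+L(\gamma))\|^2\big)_{u,w\in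 V(G),\,\gamma\in\Gamma}$. The framework $(G,\psi,p)$ is $L$-periodically globally rigid (resp. $L$-periodically rigid) if for every $q:V(G)\to\mathbb{R}^d$ (resp. for every $q$ in some neighbourhood of $p$), $f_{G,L}(p)=f_{G,L}(q)$ implies $f_{V(G),L}(p)=f_{V(G),L}(q)$. For a vertex $v$, with all edges at $v$ oriented from $v$, let $(G_v,\psi_v)$ be the $\Gamma$-labelled graph obtained from $(G,\psi)$ by removing $v$ and inserting, unless it is already present, for every pair of nonparallel edges $e_1=vu$, $e_2=vw$ (so $u\neq w$) an edge from $u$ to $w$ with label $\psi(e_1)^{-1}\psi(e_2)$. **Lemma.** Let $(G,\psi,p)$ be a generic $\Gamma$-labelled framework in $\mathbb{R}^d$ with $|V(G)|\ge d-k+1$. Suppose that a vertex $v$ of $G$ has neighbours $\gamma_0v_0,\dots,\gamma_dv_d$ in the covering $\tilde G$ such that $\tilde p(\gamma_0v_0),\dots,\tilde p(\gamma_dv_d)$ affinely span $\mathbb{R}^d$. Let $p'=p|_{V(G)-v}$, and suppose further that $(G-v,\psi|_{G-v},p')$ is $L$-periodically rigid and that $(G_v,\psi_v,p')$ is $L$-periodically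 globally rigid. Then $(G,\psi,p)$ is $L$-periodically globally rigid. -/

import Mathlib

open scoped Topology

/-- A `Γ`-labelled graph `(G, ψ)` on the vertex set `V`: a directed multigraph with edge set `E`,
every edge `e` going from `src e` to `tgt e` and carrying the label `label e` (the free abelian
group `Γ` is written additively). There are no loops, and no two parallel edges have the same
label when oriented in the same direction; the second clause of `no_parallel` is the case of two
edges whose given orientations are opposite. -/
structure LabelledGraph (Γ V E : Type*) [AddCommGroup Γ] where
  src : E → V
  tgt : E → V
  label : E → Γ
  finite_edges : Finite E
  no_loop : ∀ e, src e ≠ tgt e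
  no_parallel : ∀ e e',
    ((src e = src e' ∧ tgt e = tgt e' ∧ label e = label e') ∨
      (src e = tgt e' ∧ tgt e = src e' ∧ label e = -label e')) → e = e'

namespace LabelledGraph

variable {Γ V E : Type*} [AddCommGroup Γ]

/-- `G.HasEdge u w γ`: there is an edge between `u` and `w` which has label `γ` when it is
oriented from `u` to `w`. -/
def HasEdge (G : LabelledGraph Γ V E) (u w : V) (γ : Γ) : Prop :=
  ∃ e, (G.src e = u ∧ G.tgt e = w ∧ G.label e = γ) ∨
    (G.tgt e = u ∧ G.src e = w ∧ -G.label e = γ)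

theorem HasEdge.symm {G : LabelledGraph Γ V E} {u w : V} {γ : Γ} (h : G.HasEdge u w γ) :
    G.HasEdge w u (-γ) := by
  obtain ⟨e, ⟨h1, h2, h3⟩ | ⟨h1, h2, h3⟩⟩ := h
  · exact ⟨e, Or.inr ⟨h2, h1, by rw [h3]⟩⟩
  · exact ⟨e, Or.inl ⟨h2, h1, by rw [← h3, neg_neg]⟩⟩

theorem HasEdge.ne {G : LabelledGraph Γ V E} {u w : V} {γ : Γ} (h : G.HasEdge u w γ) :
    u ≠ w := by
  obtain ⟨e, ⟨h1, h2, -⟩ | ⟨h1, h2, -⟩⟩ := h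
  · rw [← h1, ← h2]; exact G.no_loop e
  · rw [← h1, ← h2]; exact (G.no_loop e).symm

theorem finite_hasEdge (G : LabelledGraph Γ V E) :
    {t : V × V × Γ | G.HasEdge t.1 t.2.1 t.2.2}.Finite := by
  have := G.finite_edges
  refine ((Set.finite_range fun e => (G.src e, G.tgt e, G.label e)).union
    (Set.finite_range fun e => (G.tgt e, G.src e, -G.label e))).subset ?_
  rintro ⟨u, w, γ⟩ ⟨e, ⟨rfl, rfl, rfl⟩ | ⟨rfl, rfl, rfl⟩⟩
  · exact Or.inl ⟨e, rfl⟩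
  · exact Or.inr ⟨e, rfl⟩

/-- The covering of `(G, ψ)`, with vertex set `{γ v : γ ∈ Γ, v ∈ V}`: every edge `e` from `u` to
`w` with label `ψ(e)` gives the edges joining `γ u` and `(ψ(e) + γ) w`, for `γ ∈ Γ`. -/
def covering (G : LabelledGraph Γ V E) : SimpleGraph (Γ × V) where
  Adj x y := ∃ (e : E) (γ : Γ),
    (x = (γ, G.src e) ∧ y = (G.label e + γ, G.tgt e)) ∨
      (y = (γ, G.src e) ∧ x = (G.label e + γ, G.tgt e))
  symm := ⟨fun _ _ ⟨e, γ, h⟩ => ⟨e, γ, h.symm⟩⟩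
  loopless := ⟨by
    rintro x ⟨e, γ, ⟨h1, h2⟩ | ⟨h1, h2⟩⟩ <;>
      exact G.no_loop e (congrArg Prod.snd (h1.symm.trans h2))⟩

/-- The `Γ`-labelled graph `G - v`. -/
def deleteVertex (G : LabelledGraph Γ V E) (v : V) :
    LabelledGraph Γ {u : V // u ≠ v} {e : E // G.src e ≠ v ∧ G.tgt e ≠ v} where
  src e := ⟨G.src e.1, e.2.1⟩
  tgt e := ⟨G.tgt e.1, e.2.2⟩
  label e := G.label e.1
  finite_edges := by
    have := G.finite_edges
    infer_instance
  no_loop e h := G.no_loop e.1 (congrArg Subtype.val h)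
  no_parallel e e' h := Subtype.ext (G.no_parallel e.1 e'.1 (by simpa using h))

/-- Two oriented labelled edges are identified if they are equal or reverse to one another. -/
def reversalSetoid (R : V → V → Γ → Prop) : Setoid {t : V × V × Γ // R t.1 t.2.1 t.2.2} where
  r s t := s = t ∨
    (s.1.1 = t.1.2.1 ∧ s.1.2.1 = t.1.1 ∧ s.1.2.2 = -t.1.2.2)
  iseqv :=
    { refl := fun _ => Or.inl rfl
      symm := by
        rintro s t (h | ⟨h1, h2, h3⟩)
        · exact Or.inl h.symm
        · exact Or.inr ⟨h2.symm, h1.symm, by rw [h3, neg_neg]⟩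
      trans := by
        rintro s t r (rfl | ⟨h1, h2, h3⟩) (rfl | ⟨h4, h5, h6⟩)
        · exact Or.inl rfl
        · exact Or.inr ⟨h4, h5, h6⟩
        · exact Or.inr ⟨h1, h2, h3⟩
        · refine Or.inl (Subtype.ext (Prod.ext (h1.trans h5) (Prod.ext (h2.trans h4) ?_)))
          rw [h3, h6, neg_neg] }

/-- The `Γ`-labelled graph with exactly one edge for every pair of mutually reverse labelled edges
`(u, w, γ)`, `(w, u, -γ)` satisfying `R`, with an arbitrary one of the two as orientation. -/
noncomputable def ofRel (R : V → V → Γ → Prop)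
    (hfin : {t : V × V × Γ | R t.1 t.2.1 t.2.2}.Finite) (hne : ∀ u w γ, R u w γ → u ≠ w) :
    LabelledGraph Γ V (Quotient (reversalSetoid R)) where
  src e := e.out.1.1
  tgt e := e.out.1.2.1
  label e := e.out.1.2.2
  finite_edges := by
    have : Finite {t : V × V × Γ // R t.1 t.2.1 t.2.2} := hfin.to_subtype
    infer_instance
  no_loop e := hne _ _ _ e.out.2
  no_parallel e e' h := by
    rw [← Quotient.out_equiv_out]
    rcases h with ⟨h1, h2, h3⟩ | h
    · exact Or.inl (Subtype.ext (Prod.ext h1 (Prod.ext h2 h3)))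
    · exact Or.inr h

theorem hasEdge_ofRel {R : V → V → Γ → Prop}
    {hfin : {t : V × V × Γ | R t.1 t.2.1 t.2.2}.Finite} {hne : ∀ u w γ, R u w γ → u ≠ w}
    (hsymm : ∀ u w γ, R u w γ → R w u (-γ)) (u w : V) (γ : Γ) :
    (ofRel R hfin hne).HasEdge u w γ ↔ R u w γ := by
  constructor
  · rintro ⟨e, ⟨rfl, rfl, rfl⟩ | ⟨rfl, rfl, rfl⟩⟩
    · exact e.out.2
    · exact hsymm _ _ _ e.out.2
  · intro h
    let t : {t : V × V × Γ // R t.1 t.2.1 t.2.2} := ⟨(u, w, γ), h⟩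
    refine ⟨Quotient.mk (reversalSetoid R) t, ?_⟩
    have ht : (reversalSetoid R).r (Quotient.mk (reversalSetoid R) t).out t :=
      Quotient.exact (Quotient.out_eq _)
    rcases ht with ht | ⟨h1, h2, h3⟩
    · left
      simp only [ofRel, ht]
      exact ⟨rfl, rfl, rfl⟩
    · right
      exact ⟨h2, h1, by simp only [ofRel]; rw [h3, neg_neg]⟩

/-- The labelled edges of `G_v`: those of `G - v`, and for any two nonparallel edges `e₁` from `v`
to `u` and `e₂` from `v` to `w` (so `u ≠ w`) the edge `e₁ · e₂` from `u` to `w` with label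
`-ψ(e₁) + ψ(e₂)`. -/
def ReducedEdge (G : LabelledGraph Γ V E) (v : V) (u w : {u : V // u ≠ v}) (γ : Γ) : Prop :=
  G.HasEdge u w γ ∨
    (u ≠ w ∧ ∃ α β : Γ, G.HasEdge v u α ∧ G.HasEdge v w β ∧ γ = -α + β)

theorem ReducedEdge.symm {G : LabelledGraph Γ V E} {v : V} {u w : {u : V // u ≠ v}} {γ : Γ}
    (h : G.ReducedEdge v u w γ) : G.ReducedEdge v w u (-γ) := by
  rcases h with h | ⟨hne, α, β, hα, hβ, rfl⟩
  · exact Or.inl h.symm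
  · exact Or.inr ⟨hne.symm, β, α, hβ, hα, by abel⟩

theorem ReducedEdge.ne {G : LabelledGraph Γ V E} {v : V} (u w : {u : V // u ≠ v}) (γ : Γ)
    (h : G.ReducedEdge v u w γ) : u ≠ w := by
  rcases h with h | ⟨hne, -⟩
  · exact fun huw => h.ne (congrArg Subtype.val huw)
  · exact hne

theorem finite_reducedEdge (G : LabelledGraph Γ V E) (v : V) :
    {t : {u : V // u ≠ v} × {u : V // u ≠ v} × Γ | G.ReducedEdge v t.1 t.2.1 t.2.2}.Finite := by
  have hF := G.finite_hasEdge
  have hinj : Function.Injective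
      (fun t : {u : V // u ≠ v} × {u : V // u ≠ v} × Γ => ((t.1 : V), (t.2.1 : V), t.2.2)) := by
    rintro ⟨⟨a, _⟩, ⟨b, _⟩, c⟩ ⟨⟨a', _⟩, ⟨b', _⟩, c'⟩ h
    simp only [Prod.mk.injEq] at h
    obtain ⟨rfl, rfl, rfl⟩ := h
    rfl
  refine Set.Finite.of_finite_image (f := fun t => ((t.1 : V), (t.2.1 : V), t.2.2)) ?_
    hinj.injOn
  refine (hF.union ((hF.prod hF).image
    (fun s => (s.1.2.1, s.2.2.1, -s.1.2.2 + s.2.2.2)))).subset ?_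
  rintro _ ⟨⟨u, w, γ⟩, h | ⟨-, α, β, hα, hβ, hγ⟩, rfl⟩
  · exact Or.inl h
  · refine Or.inr ⟨((v, (u : V), α), (v, (w : V), β)), ⟨hα, hβ⟩, ?_⟩
    simp only at hγ
    simp [hγ]

/-- The `Γ`-labelled graph `(G_v, ψ_v)`, obtained from `(G, ψ)` by removing `v` and inserting
`e₁ · e₂`, unless already present, for every pair of nonparallel edges `e₁, e₂` at `v`.
(The orientations of its edges are arbitrary.) -/
noncomputable def reduce (G : LabelledGraph Γ V E) (v : V) :
    LabelledGraph Γ {u : V // u ≠ v} (Quotient (reversalSetoid (G.ReducedEdge v))) :=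
  ofRel (G.ReducedEdge v) (G.finite_reducedEdge v) ReducedEdge.ne

/-- The labelled edges of `G_v` are those of `ReducedEdge`. -/
theorem hasEdge_reduce (G : LabelledGraph Γ V E) (v : V) (u w : {u : V // u ≠ v}) (γ : Γ) :
    (G.reduce v).HasEdge u w γ ↔ G.ReducedEdge v u w γ :=
  hasEdge_ofRel (fun _ _ _ h => h.symm) u w γ

end LabelledGraph

section Frameworks

variable {Γ V E : Type*} [AddCommGroup Γ] {d : ℕ}

/-- `L : Γ → ℝᵈ` is nonsingular, for `Γ` of rank `k`: the lattice `L(Γ)` spans a `k`-dimensional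
linear subspace. -/
def IsNonsingular (k : ℕ) (L : Γ →+ EuclideanSpace ℝ (Fin d)) : Prop :=
  Module.finrank ℝ (Submodule.span ℝ (Set.range L)) = k

/-- The `L`-periodic placement `p̃ (γ v) = p v + L γ` of the covering determined by `p`. -/
def coveringPlacement (L : Γ →+ EuclideanSpace ℝ (Fin d)) (p : V → EuclideanSpace ℝ (Fin d)) :
    Γ × V → EuclideanSpace ℝ (Fin d) :=
  fun x => p x.2 + L x.1

/-- The field `ℚ(L)` generated by the coordinates of the lattice vectors `L γ`. -/
noncomputable def latticeField (L : Γ →+ EuclideanSpace ℝ (Fin d)) : IntermediateField ℚ ℝ :=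
  IntermediateField.adjoin ℚ {x : ℝ | ∃ (γ : Γ) (i : Fin d), x = L γ i}

/-- `p` is generic with respect to the lattice `L`: its `d |V|` coordinates are algebraically
independent over `ℚ(L)` (over `ℚ` if `L` is rational). Equivalently, the coordinates of the
covering satisfy no polynomial relation over `ℚ` beyond those in the ideal generated by the
relations `p̃ (γ v) = p̃ v + L γ`: eliminating the coordinates of `p̃ (γ v)` by these relations
turns the polynomials over `ℚ` in the coordinates of the covering into the polynomials over
`ℚ[L]` in the coordinates of `p`. -/
def IsGenericPlacement (L : Γ →+ EuclideanSpace ℝ (Fin d))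
    (p : V → EuclideanSpace ℝ (Fin d)) : Prop :=
  AlgebraicIndependent (latticeField L) (fun x : V × Fin d => p x.1 x.2)

/-- The length-squared function `f_{G,L}`. -/
noncomputable def lengthSq (G : LabelledGraph Γ V E) (L : Γ →+ EuclideanSpace ℝ (Fin d))
    (p : V → EuclideanSpace ℝ (Fin d)) : E → ℝ :=
  fun e => ‖p (G.src e) - (p (G.tgt e) + L (G.label e))‖ ^ 2

/-- The length-squared function `f_{V,L}` of the complete `Γ`-labelled graph on `V`, which has an
edge from `u` to `w` with label `γ` for all `u, w ∈ V` and `γ ∈ Γ`. -/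
noncomputable def completeLengthSq (L : Γ →+ EuclideanSpace ℝ (Fin d))
    (p : V → EuclideanSpace ℝ (Fin d)) : V × V × Γ → ℝ :=
  fun x => ‖p x.1 - (p x.2.1 + L x.2.2)‖ ^ 2

/-- `(G, ψ, p)` is `L`-periodically globally rigid. -/
def IsPeriodicallyGloballyRigid (G : LabelledGraph Γ V E)
    (L : Γ →+ EuclideanSpace ℝ (Fin d)) (p : V → EuclideanSpace ℝ (Fin d)) : Prop :=
  ∀ q : V → EuclideanSpace ℝ (Fin d),
    lengthSq G L p = lengthSq G L q → completeLengthSq L p = completeLengthSq L q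

/-- `(G, ψ, p)` is `L`-periodically rigid. -/
def IsPeriodicallyRigid (G : LabelledGraph Γ V E)
    (L : Γ →+ EuclideanSpace ℝ (Fin d)) (p : V → EuclideanSpace ℝ (Fin d)) : Prop :=
  ∀ᶠ q in 𝓝 p,
    lengthSq G L p = lengthSq G L q → completeLengthSq L p = completeLengthSq L q

end Frameworks

/-! ### Directional derivatives of polynomials at a generic point. -/

section PolynomialMaps

open MvPolynomial

variable {F σ : Type*} [Field F] [Algebra F ℝ] [Fintype σ]

/-! Let `q` have the edge lengths of `p`, and let `K` be the algebraic closure in `ℝ` of `ℚ(L)(p')`,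
where `p'` is `p` without `v`. The coordinates of `p v` are algebraically independent over `K`.

Local rigidity of `G - v` at the generic point `p'` makes every squared length algebraic over the
edge lengths, as polynomials (`isAlgebraic_adjoin_of_eventually`). Such a relation can be evaluated
at any placement with the same edge lengths, however far from `p'`, so all squared lengths of `q`
off `v` lie in `K` (`isAlgebraic_aeval_of_eventually`).

Let `a j` and `b j` be the neighbours of `v` in the covering, placed by `p` and by `q`. The vector
from a base point among the `b j` to `q v` is determined by its inner products with differences of
the `b j`, and these are affine functions over `K` of `p v`. So `q v` is the image of `p v` under an
affine map `z ↦ W z + b₀`. The equations `‖W z + b₀ - b j‖ = ‖z - a j‖` hold at the generic point `p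
v`, hence for all `z`; taking `z = a i` gives `W (a i) + b₀ = b i` and `‖b i - b j‖ = ‖a i - a j‖`
(`norm_sub_sq_eq_of_generic`).

Thus the edges of `G_v` keep their lengths, and its global rigidity fixes all lengths off `v`.
Lengths at `v` follow because its neighbours affinely span (`norm_sub_sq_eq_of_affineSpan_eq_top`).
-/

theorem analyticAt_aeval_mvPolynomial (a : MvPolynomial σ F) (z : σ → ℝ) :
    AnalyticAt ℝ (fun z : σ → ℝ => aeval z a) z :=
  AnalyticAt.aeval_mvPolynomial
    (fun i => (ContinuousLinearMap.proj (R := ℝ) (φ := fun _ : σ => ℝ) i).analyticAt z) a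

theorem continuous_aeval_mvPolynomial (a : MvPolynomial σ F) :
    Continuous (fun z : σ → ℝ => aeval z a) :=
  continuous_iff_continuousAt.2 fun z => (analyticAt_aeval_mvPolynomial a z).continuousAt

theorem fderiv_aeval_add (a b : MvPolynomial σ F) (p v : σ → ℝ) :
    fderiv ℝ (fun z : σ → ℝ => aeval z (a + b)) p v =
      fderiv ℝ (fun z : σ → ℝ => aeval z a) p v + fderiv ℝ (fun z : σ → ℝ => aeval z b) p v := by
  simp only [map_add]
  rw [fderiv_fun_add (analyticAt_aeval_mvPolynomial a p).differentiableAt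
    (analyticAt_aeval_mvPolynomial b p).differentiableAt]
  rfl

theorem fderiv_aeval_mul (a b : MvPolynomial σ F) (p v : σ → ℝ) :
    fderiv ℝ (fun z : σ → ℝ => aeval z (a * b)) p v =
      aeval p a * fderiv ℝ (fun z : σ → ℝ => aeval z b) p v +
        aeval p b * fderiv ℝ (fun z : σ → ℝ => aeval z a) p v := by
  simp only [map_mul]
  rw [fderiv_fun_mul (analyticAt_aeval_mvPolynomial a p).differentiableAt
    (analyticAt_aeval_mvPolynomial b p).differentiableAt]
  rfl

omit [Fintype σ] in
theorem fderiv_aeval_algebraMap (c : F) (p v : σ → ℝ) :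
    fderiv ℝ (fun z : σ → ℝ => aeval z (algebraMap F (MvPolynomial σ F) c)) p v = 0 := by
  simp only [AlgHom.commutes]
  simp

omit [Fintype σ] in
theorem fderiv_aeval_X (i : σ) (p v : σ → ℝ) :
    fderiv ℝ (fun z : σ → ℝ => aeval z (X i : MvPolynomial σ F)) p v = v i := by
  simp only [aeval_X]
  exact congrArg (· v)
    (ContinuousLinearMap.proj (R := ℝ) (φ := fun _ : σ => ℝ) i).hasFDerivAt.fderiv

variable {p v : σ → ℝ} {T : Set (MvPolynomial σ F)}

/-- A directional derivative which kills `T` kills the subalgebra generated by `T`. -/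
theorem fderiv_aeval_eq_zero_of_mem_adjoin
    (hv : ∀ t ∈ T, fderiv ℝ (fun z : σ → ℝ => aeval z t) p v = 0)
    {a : MvPolynomial σ F} (ha : a ∈ Algebra.adjoin F T) :
    fderiv ℝ (fun z : σ → ℝ => aeval z a) p v = 0 := by
  induction ha using Algebra.adjoin_induction with
  | mem t ht => exact hv t ht
  | algebraMap c => exact fderiv_aeval_algebraMap c p v
  | add a b _ _ ha hb => rw [fderiv_aeval_add, ha, hb, add_zero]
  | mul a b _ _ ha hb => rw [fderiv_aeval_mul, ha, hb, mul_zero, mul_zero, add_zero]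

/-- The chain rule for a directional derivative which kills the coefficients. -/
theorem fderiv_aeval_polynomial_aeval
    (hv : ∀ t ∈ T, fderiv ℝ (fun z : σ → ℝ => aeval z t) p v = 0)
    (a : MvPolynomial σ F) (P : Polynomial (Algebra.adjoin F T)) :
    fderiv ℝ (fun z : σ → ℝ => aeval z (Polynomial.aeval a P)) p v =
      aeval p (Polynomial.aeval a P.derivative) *
        fderiv ℝ (fun z : σ → ℝ => aeval z a) p v := by
  have hpow : ∀ n : ℕ, fderiv ℝ (fun z : σ → ℝ => aeval z (a ^ n)) p v =
      n * aeval p a ^ (n - 1) * fderiv ℝ (fun z : σ → ℝ => aeval z a) p v := by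
    intro n
    induction n with
    | zero => simp
    | succ n ih =>
      rw [pow_succ, fderiv_aeval_mul, ih]
      rcases n with _ | n
      · simp
      · simp only [map_pow, Nat.add_sub_cancel, Nat.cast_add, Nat.cast_one]
        ring
  induction P using Polynomial.induction_on' with
  | add P Q hP hQ =>
    rw [map_add, fderiv_aeval_add, hP, hQ, Polynomial.derivative_add, map_add, map_add, add_mul]
  | monomial n c =>
    rw [Polynomial.aeval_monomial, fderiv_aeval_mul, hpow, Polynomial.derivative_monomial,
      Polynomial.aeval_monomial]
    have hc : fderiv ℝ (fun z : σ → ℝ => aeval z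
        (algebraMap (Algebra.adjoin F T) (MvPolynomial σ F) c)) p v = 0 :=
      fderiv_aeval_eq_zero_of_mem_adjoin hv c.2
    rw [hc, map_mul (algebraMap (Algebra.adjoin F T) (MvPolynomial σ F)), map_mul, map_mul,
      map_natCast, map_natCast]
    simp only [map_pow]
    ring

/-- At a generic point, a directional derivative which kills `T` kills everything algebraic
over `T`. -/
theorem fderiv_aeval_eq_zero_of_isAlgebraic (hp : AlgebraicIndependent F p)
    (hv : ∀ t ∈ T, fderiv ℝ (fun z : σ → ℝ => aeval z t) p v = 0)
    {a : MvPolynomial σ F} (ha : IsAlgebraic (Algebra.adjoin F T) a) :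
    fderiv ℝ (fun z : σ → ℝ => aeval z a) p v = 0 := by
  have : CharZero F := (algebraMap F ℝ).charZero
  obtain ⟨P, hP0, hPa⟩ := ha
  induction hn : P.natDegree using Nat.strong_induction_on generalizing P with
  | _ n ih =>
    have key := fderiv_aeval_polynomial_aeval hv a P
    rw [hPa] at key
    have h0 : fderiv ℝ (fun z : σ → ℝ => aeval z (0 : MvPolynomial σ F)) p v = 0 := by simp
    rw [h0] at key
    -- Either the derivative of `a` vanishes, or `P'(a)` vanishes at `p`. In the second case
    -- genericity gives `P'(a) = 0`, and the nonzero polynomial `P'` of smaller degree replaces `P`.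
    rcases mul_eq_zero.1 key.symm with h | h
    · have h' : Polynomial.aeval a P.derivative = 0 := hp (by rw [h, map_zero])
      have hdeg : P.natDegree ≠ 0 := by
        intro hdeg
        rw [Polynomial.eq_C_of_natDegree_eq_zero hdeg, Polynomial.aeval_C] at hPa
        apply hP0
        rw [Polynomial.eq_C_of_natDegree_eq_zero hdeg]
        have : P.coeff 0 = 0 := Subtype.ext hPa
        rw [this, Polynomial.C_0]
      refine ih P.derivative.natDegree ?_ P.derivative ?_ h' rfl
      · rw [← hn]; exact Polynomial.natDegree_derivative_lt hdeg
      · intro h0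
        exact hdeg (Polynomial.derivative_eq_zero.1 h0)
    · exact h

/-- The polynomial map given by a transcendence basis is a local homeomorphism at a generic
point. -/
theorem exists_hasStrictFDerivAt_equiv_of_isTranscendenceBasis {B : Set (MvPolynomial σ F)}
    [Fintype B] (hp : AlgebraicIndependent F p)
    (hB : IsTranscendenceBasis F ((↑) : B → MvPolynomial σ F)) :
    ∃ f' : (σ → ℝ) ≃L[ℝ] (B → ℝ),
      HasStrictFDerivAt (fun (z : σ → ℝ) (b : B) => aeval z b.1) (f' : (σ → ℝ) →L[ℝ] (B → ℝ)) p := by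
  let f₀ : (σ → ℝ) →L[ℝ] (B → ℝ) :=
    ContinuousLinearMap.pi fun b => fderiv ℝ (fun z : σ → ℝ => aeval z b.1) p
  have hf₀ : HasStrictFDerivAt (fun (z : σ → ℝ) (b : B) => aeval z b.1) f₀ p :=
    hasStrictFDerivAt_pi.2 fun b =>
      (analyticAt_aeval_mvPolynomial b.1 p).hasStrictFDerivAt
  have hinj : Function.Injective (f₀ : (σ → ℝ) →ₗ[ℝ] (B → ℝ)) := by
    rw [injective_iff_map_eq_zero]
    intro v hv
    have halg := hB.isAlgebraic
    rw [Subtype.range_coe] at halg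
    funext i
    rw [← fderiv_aeval_X (F := F) i p v]
    exact fderiv_aeval_eq_zero_of_isAlgebraic hp (T := B)
      (fun t ht => congrFun hv ⟨t, ht⟩) (halg.isAlgebraic _)
  -- The variables and `B` are two transcendence bases of the same polynomial ring, so the injective
  -- derivative is square.
  have hcard : Fintype.card σ = Fintype.card B := by
    have := (IsTranscendenceBasis.mvPolynomial σ F).lift_cardinalMk_eq hB
    simpa using this
  have hrank : Module.finrank ℝ (σ → ℝ) = Module.finrank ℝ (B → ℝ) := by simpa using hcard
  refine ⟨(LinearEquiv.ofInjectiveOfFinrankEq (f₀ : (σ → ℝ) →ₗ[ℝ] (B → ℝ)) hinj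
    hrank).toContinuousLinearEquiv, ?_⟩
  convert hf₀
  exact ContinuousLinearMap.ext fun v =>
    LinearMap.congr_fun (LinearEquiv.coe_ofInjectiveOfFinrankEq _ hinj hrank) v

end PolynomialMaps

/-! ### Local determination of values implies algebraic dependence. -/

section LocalDetermination

open MvPolynomial

variable {F σ : Type*} [Field F] [Algebra F ℝ]

/-- Points at which the elements of `S` take the same values give the same value to every
element of the subalgebra generated by `S`. -/
theorem aeval_eq_of_mem_adjoin {p q : σ → ℝ} {S : Set (MvPolynomial σ F)}
    (h : ∀ s ∈ S, aeval q s = aeval p s) {a : MvPolynomial σ F}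
    (ha : a ∈ Algebra.adjoin F S) : aeval q a = aeval p a := by
  induction ha using Algebra.adjoin_induction with
  | mem s hs => exact h s hs
  | algebraMap c => simp
  | add a b _ _ ha hb => rw [map_add, map_add, ha, hb]
  | mul a b _ _ ha hb => rw [map_mul, map_mul, ha, hb]

/-- If `a` is algebraic over the subalgebra generated by `S` and `p` is generic, then the value
of `a` at any point at which `S` takes the same values as at `p` is a root of a fixed nonzero
polynomial, whose coefficients are polynomials in `p`. -/
theorem exists_polynomial_root_of_isAlgebraic {p : σ → ℝ} (hp : AlgebraicIndependent F p)
    {S : Set (MvPolynomial σ F)} {a : MvPolynomial σ F}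
    (ha : IsAlgebraic (Algebra.adjoin F S) a) :
    ∃ P : Polynomial (MvPolynomial σ F), P.map (aeval p : MvPolynomial σ F →ₐ[F] ℝ).toRingHom ≠ 0 ∧
      ∀ q : σ → ℝ, (∀ s ∈ S, aeval q s = aeval p s) →
        (P.map (aeval p : MvPolynomial σ F →ₐ[F] ℝ).toRingHom).IsRoot (aeval q a) := by
  obtain ⟨P, hP0, hPa⟩ := ha
  refine ⟨P.map (algebraMap _ _), ?_, fun q hq => ?_⟩
  · rw [Polynomial.map_map]
    exact (Polynomial.map_ne_zero_iff fun x y h => Subtype.val_injective (hp h)).2 hP0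
  · have hcomp : (aeval p : MvPolynomial σ F →ₐ[F] ℝ).toRingHom.comp
        (algebraMap (Algebra.adjoin F S) (MvPolynomial σ F)) =
        (aeval q : MvPolynomial σ F →ₐ[F] ℝ).toRingHom.comp
        (algebraMap (Algebra.adjoin F S) (MvPolynomial σ F)) :=
      RingHom.ext fun r => (aeval_eq_of_mem_adjoin hq r.2).symm
    rw [Polynomial.map_map, hcomp, Polynomial.IsRoot.def, Polynomial.eval_map]
    have := Polynomial.hom_eval₂ P (algebraMap (Algebra.adjoin F S) (MvPolynomial σ F))
      (aeval q : MvPolynomial σ F →ₐ[F] ℝ).toRingHom a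
    rw [Polynomial.aeval_def] at hPa
    rw [hPa, map_zero] at this
    exact this.symm

/-- If near a generic point `p` the values of `S` determine the value of `g`, then `g` is
algebraic over `S`. -/
theorem isAlgebraic_adjoin_of_eventually [Fintype σ] {p : σ → ℝ} (hp : AlgebraicIndependent F p)
    {S : Set (MvPolynomial σ F)} {g : MvPolynomial σ F}
    (hg : ∀ᶠ q in 𝓝 p, (∀ s ∈ S, aeval q s = aeval p s) → aeval q g = aeval p g) :
    IsAlgebraic (Algebra.adjoin F S) g := by
  classical
  have hinj : Function.Injective (algebraMap F (MvPolynomial σ F)) := C_injective σ F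
  have : FaithfulSMul F (MvPolynomial σ F) := (faithfulSMul_iff_algebraMap_injective _ _).2 hinj
  -- `T` is a maximal algebraically independent subset of `S`. If `g` were transcendental over it,
  -- `T ∪ {g}` would extend to a transcendence basis `B`, whose elements are local coordinates at
  -- `p`.
  obtain ⟨T, hT⟩ := (AlgebraicIndependent.matroid F (MvPolynomial σ F)).exists_isBasis S
    (Set.subset_univ _)
  by_contra hcon
  have hcon' : Transcendental (Algebra.adjoin F T) g := fun h =>
    hcon ((AlgebraicIndependent.isAlgebraic_adjoin_iff_of_matroid_isBasis hT).1 h)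
  obtain ⟨hTi, hTS, hTalg⟩ := AlgebraicIndependent.matroid_isBasis_iff.1 hT
  have hgT : g ∉ T := fun h => hcon'
    (isAlgebraic_algebraMap (⟨g, Algebra.subset_adjoin h⟩ : Algebra.adjoin F T))
  have hins : AlgebraicIndepOn F id (insert g T) := hTi.insert (by rwa [Set.image_id])
  obtain ⟨B, hTB, hB⟩ := exists_isTranscendenceBasis_superset hins
  have hBfin : Finite B := by
    have := (IsTranscendenceBasis.mvPolynomial σ F).lift_cardinalMk_eq hB
    rw [← Cardinal.mk_lt_aleph0_iff, ← Cardinal.lift_lt_aleph0, ← this]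
    simp
  have := Fintype.ofFinite B
  obtain ⟨f', hf'⟩ := exists_hasStrictFDerivAt_equiv_of_isTranscendenceBasis hp hB
  let e := hf'.toOpenPartialHomeomorph _
  have hpe : p ∈ e.source := hf'.mem_toOpenPartialHomeomorph_source
  have hee : ∀ z b, e z b = aeval z b.1 := fun z b => rfl
  let g₀ : B := ⟨g, hTB (Set.mem_insert _ _)⟩
  -- the path along which only the coordinate `g` changes
  let c : ℝ → B → ℝ := fun t => e p + t • Pi.single g₀ 1
  have hc : Continuous c := by fun_prop
  have hc0 : c 0 = e p := by simp [c]
  have htgt : ∀ᶠ t in 𝓝 (0 : ℝ), c t ∈ e.target :=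
    hc.continuousAt.eventually_mem (by rw [hc0]; exact e.open_target.mem_nhds (e.map_source hpe))
  have hlim : Filter.Tendsto (fun t => e.symm (c t)) (𝓝 0) (𝓝 p) := by
    have h1 : ContinuousAt e.symm (c 0) := by
      rw [hc0]; exact e.symm.continuousAt (e.map_source hpe)
    have h2 : Filter.Tendsto (fun t => e.symm (c t)) (𝓝 0) (𝓝 (e.symm (c 0))) :=
      h1.comp hc.continuousAt
    rwa [hc0, e.left_inv hpe] at h2
  obtain ⟨ε, hε, hball⟩ := Metric.eventually_nhds_iff_ball.1 (htgt.and (hlim.eventually hg))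
  let I := Metric.ball (0 : ℝ) ε
  have hI0 : (0 : ℝ) ∈ I := Metric.mem_ball_self hε
  have hIpre : IsPreconnected I := (convex_ball _ _).isPreconnected
  have hcont : ContinuousOn (fun t => e.symm (c t)) I :=
    e.symm.continuousOn.comp hc.continuousOn fun t ht => (hball t ht).1
  have hval : ∀ t ∈ I, ∀ b : B, aeval (e.symm (c t)) b.1 = c t b := fun t ht b => by
    rw [← hee, e.right_inv (hball t ht).1]
  have hTval : ∀ t ∈ I, ∀ s ∈ T, aeval (e.symm (c t)) s = aeval p s := by
    intro t ht s hs
    have hne : (⟨s, hTB (Set.mem_insert_of_mem _ hs)⟩ : B) ≠ g₀ := fun h =>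
      hgT (by rwa [← show s = g from congrArg Subtype.val h])
    rw [hval t ht ⟨s, hTB (Set.mem_insert_of_mem _ hs)⟩]
    simp [c, hne, hee]
  have hSval : ∀ t ∈ I, ∀ s ∈ S, aeval (e.symm (c t)) s = aeval p s := by
    intro t ht s hs
    obtain ⟨P, hP0, hP⟩ := exists_polynomial_root_of_isAlgebraic hp (hTalg s hs)
    have h0 : e.symm (c 0) = p := by rw [hc0, e.left_inv hpe]
    rw [← h0]
    -- Along the path `T` is constant, so `s` takes values in the finite root set of one polynomial;
    -- a continuous function from an interval to such a set is constant.
    refine hIpre.constant_of_mapsTo (Polynomial.finite_setOfPred_isRoot hP0).isDiscrete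
      (f := fun t => aeval (e.symm (c t)) s)
      ((continuous_aeval_mvPolynomial s).comp_continuousOn hcont) ?_ ht hI0
    exact fun t ht => hP _ (hTval t ht)
  have hhalf : ε / 2 ∈ I := by
    rw [Metric.mem_ball, dist_zero_right, Real.norm_of_nonneg (by positivity)]
    linarith
  have hgval := (hball _ hhalf).2 (hSval _ hhalf)
  rw [hval _ hhalf g₀] at hgval
  simp only [c, Pi.add_apply, hee, Pi.smul_apply, Pi.single_eq_same, smul_eq_mul, mul_one] at hgval
  have : aeval p g + ε / 2 = aeval p g := hgval
  linarith

/-- If near a generic point `p` the values of `S` determine the value of `g`, and `S` takes the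
same values at `q` as at `p`, then the value of `g` at `q` is algebraic over the field generated
by `p`. -/
theorem isAlgebraic_aeval_of_eventually [Fintype σ] {p q : σ → ℝ}
    (hp : AlgebraicIndependent F p) {S : Set (MvPolynomial σ F)} {g : MvPolynomial σ F}
    (hg : ∀ᶠ q in 𝓝 p, (∀ s ∈ S, aeval q s = aeval p s) → aeval q g = aeval p g)
    (hq : ∀ s ∈ S, aeval q s = aeval p s) :
    IsAlgebraic (Algebra.adjoin F (Set.range p)) (aeval q g) := by
  obtain ⟨P, hP0, hP⟩ := exists_polynomial_root_of_isAlgebraic hp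
    (isAlgebraic_adjoin_of_eventually hp hg)
  have hmem : ∀ a : MvPolynomial σ F, aeval p a ∈ Algebra.adjoin F (Set.range p) := fun a => by
    rw [Algebra.adjoin_range_eq_range_aeval]
    exact ⟨a, rfl⟩
  -- Evaluation at `p` with codomain cut down to `F[p]`, so that the root relation has coefficients
  -- there rather than in `ℝ`.
  let φ : MvPolynomial σ F →+* Algebra.adjoin F (Set.range p) :=
    (aeval p : MvPolynomial σ F →ₐ[F] ℝ).toRingHom.codRestrict _ hmem
  have hφ : (algebraMap (Algebra.adjoin F (Set.range p)) ℝ).comp φ =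
      (aeval p : MvPolynomial σ F →ₐ[F] ℝ).toRingHom := rfl
  refine ⟨P.map φ, fun h => hP0 ?_, ?_⟩
  · rw [← hφ, ← Polynomial.map_map, h, Polynomial.map_zero]
  · have := hP q hq
    rw [← hφ, ← Polynomial.map_map, Polynomial.IsRoot.def, Polynomial.eval_map] at this
    rwa [Polynomial.aeval_def]

end LocalDetermination

/-! ### Euclidean distances to an affinely spanning set. -/

section Distances

open scoped RealInnerProductSpace

theorem inner_sub_sub_eq {E : Type*} [NormedAddCommGroup E] [InnerProductSpace ℝ E] (x y o : E) :
    ⟪x - o, y - o⟫ = (‖x - o‖ ^ 2 + ‖y - o‖ ^ 2 - ‖x - y‖ ^ 2) / 2 := by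
  have h := norm_sub_sq_real (x - o) (y - o)
  rw [sub_sub_sub_cancel_right] at h
  linarith

/-- The distance of two points is determined by their distances to affinely spanning points. -/
theorem norm_sub_sq_eq_of_affineSpan_eq_top {E ι : Type*} [NormedAddCommGroup E]
    [InnerProductSpace ℝ E] [Fintype ι] {a b : ι → E}
    (hspan : affineSpan ℝ (Set.range a) = ⊤) (i₀ : ι)
    (hab : ∀ i j, ‖a i - a j‖ ^ 2 = ‖b i - b j‖ ^ 2) {x x' y y' : E}
    (hx : ∀ i, ‖x - a i‖ ^ 2 = ‖y - b i‖ ^ 2) (hx' : ∀ i, ‖x' - a i‖ ^ 2 = ‖y' - b i‖ ^ 2) :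
    ‖x - x'‖ ^ 2 = ‖y - y'‖ ^ 2 := by
  have hmem : x - a i₀ ∈ Submodule.span ℝ (Set.range fun i => a i - a i₀) := by
    have h := vectorSpan_range_eq_span_range_vsub_right ℝ a i₀
    rw [← direction_affineSpan, hspan, AffineSubspace.direction_top] at h
    simp only [vsub_eq_sub] at h
    rw [← h]
    trivial
  obtain ⟨s, hs⟩ := (Submodule.mem_span_range_iff_exists_fun ℝ).1 hmem
  have hAB : ∀ i j, ⟪a i - a i₀, a j - a i₀⟫ = ⟪b i - b i₀, b j - b i₀⟫ := fun i j => by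
    rw [inner_sub_sub_eq, inner_sub_sub_eq, hab, hab, hab]
  have hXA : ∀ i, ⟪x - a i₀, a i - a i₀⟫ = ⟪y - b i₀, b i - b i₀⟫ := fun i => by
    rw [inner_sub_sub_eq, inner_sub_sub_eq, hab, hx, hx]
  have hXA' : ∀ i, ⟪a i - a i₀, x' - a i₀⟫ = ⟪b i - b i₀, y' - b i₀⟫ := fun i => by
    rw [real_inner_comm, inner_sub_sub_eq, real_inner_comm, inner_sub_sub_eq, hab, hx', hx']
  -- The squared norm of the difference expands into inner products that agree on both sides, and it
  -- is zero on the side of `x`.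
  have hy : ∑ i, s i • (b i - b i₀) = y - b i₀ := by
    have h0 : ‖(y - b i₀) - ∑ i, s i • (b i - b i₀)‖ ^ 2 =
        ‖(x - a i₀) - ∑ i, s i • (a i - a i₀)‖ ^ 2 := by
      rw [norm_sub_sq_real (y - b i₀), norm_sub_sq_real (x - a i₀), hx]
      simp only [← real_inner_self_eq_norm_sq, inner_sum, sum_inner, real_inner_smul_left,
        real_inner_smul_right, hAB, hXA]
    rw [hs, sub_self, norm_zero, zero_pow two_ne_zero, sq_eq_zero_iff, norm_eq_zero,
      sub_eq_zero] at h0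
    exact h0.symm
  have hinner : ⟪x - a i₀, x' - a i₀⟫ = ⟪y - b i₀, y' - b i₀⟫ := by
    rw [← hs, ← hy]
    simp only [sum_inner, real_inner_smul_left, hXA']
  rw [inner_sub_sub_eq, inner_sub_sub_eq, hx, hx'] at hinner
  linarith

end Distances

/-! ### Distances from a generic point. -/

section GenericPoint

open MvPolynomial

open scoped RealInnerProductSpace

variable {d : ℕ} {K : Type*} [Field K] [Algebra K ℝ]

variable (K d) in
/-- The functions on `ℝᵈ` given by polynomials over `K`. -/
noncomputable def mvPolynomialFunctions : Subalgebra K (EuclideanSpace ℝ (Fin d) → ℝ) :=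
  (AlgHom.pi fun z : EuclideanSpace ℝ (Fin d) =>
    (aeval fun i => z i : MvPolynomial (Fin d) K →ₐ[K] ℝ)).range

theorem mem_mvPolynomialFunctions {g : EuclideanSpace ℝ (Fin d) → ℝ} :
    g ∈ mvPolynomialFunctions d K ↔
      ∃ P : MvPolynomial (Fin d) K, ∀ z : EuclideanSpace ℝ (Fin d),
        aeval (fun i => z i) P = g z := by
  rw [mvPolynomialFunctions, AlgHom.mem_range]
  simp only [funext_iff]
  rfl

/-- Algebraic independence makes evaluation at `x` injective on polynomials over `K`; this turns one
equation at `x` into an identity on all of `ℝᵈ`. -/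
theorem eq_zero_of_mem_mvPolynomialFunctions {x : EuclideanSpace ℝ (Fin d)}
    (hx : AlgebraicIndependent K fun i => x i) {g : EuclideanSpace ℝ (Fin d) → ℝ}
    (hg : g ∈ mvPolynomialFunctions d K) (hgx : g x = 0) (z : EuclideanSpace ℝ (Fin d)) :
    g z = 0 := by
  obtain ⟨P, hP⟩ := mem_mvPolynomialFunctions.1 hg
  have hP0 : P = 0 := hx (by rw [map_zero, hP, hgx])
  rw [← hP, hP0, map_zero]

theorem coord_mem_mvPolynomialFunctions (i : Fin d) :
    (fun z : EuclideanSpace ℝ (Fin d) => z i) ∈ mvPolynomialFunctions d K :=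
  mem_mvPolynomialFunctions.2 ⟨X i, fun _ => aeval_X _ i⟩

theorem const_mem_mvPolynomialFunctions {c : ℝ} (hc : c ∈ (algebraMap K ℝ).fieldRange) :
    (fun _ : EuclideanSpace ℝ (Fin d) => c) ∈ mvPolynomialFunctions d K := by
  obtain ⟨r, rfl⟩ := hc
  exact mem_mvPolynomialFunctions.2 ⟨C r, fun _ => aeval_C _ r⟩

theorem mul_mem_mvPolynomialFunctions {g h : EuclideanSpace ℝ (Fin d) → ℝ}
    (hg : g ∈ mvPolynomialFunctions d K) (hh : h ∈ mvPolynomialFunctions d K) :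
    (fun z => g z * h z) ∈ mvPolynomialFunctions d K :=
  (mvPolynomialFunctions d K).mul_mem hg hh

theorem add_mem_mvPolynomialFunctions {g h : EuclideanSpace ℝ (Fin d) → ℝ}
    (hg : g ∈ mvPolynomialFunctions d K) (hh : h ∈ mvPolynomialFunctions d K) :
    (fun z => g z + h z) ∈ mvPolynomialFunctions d K :=
  (mvPolynomialFunctions d K).add_mem hg hh

theorem sub_mem_mvPolynomialFunctions {g h : EuclideanSpace ℝ (Fin d) → ℝ}
    (hg : g ∈ mvPolynomialFunctions d K) (hh : h ∈ mvPolynomialFunctions d K) :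
    (fun z => g z - h z) ∈ mvPolynomialFunctions d K :=
  (mvPolynomialFunctions d K).sub_mem hg hh

theorem sum_mem_mvPolynomialFunctions {ι : Type*} (s : Finset ι)
    {g : ι → EuclideanSpace ℝ (Fin d) → ℝ} (hg : ∀ i, g i ∈ mvPolynomialFunctions d K) :
    (fun z => ∑ i ∈ s, g i z) ∈ mvPolynomialFunctions d K := by
  have h := (mvPolynomialFunctions d K).sum_mem (t := s) fun i _ => hg i
  convert h using 1
  ext z
  simp

theorem inner_mem_mvPolynomialFunctions {a u : EuclideanSpace ℝ (Fin d)}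
    (ha : ∀ i, a i ∈ (algebraMap K ℝ).fieldRange) (hu : ∀ i, u i ∈ (algebraMap K ℝ).fieldRange) :
    (fun z => ⟪u, z - a⟫) ∈ mvPolynomialFunctions d K := by
  have h := sum_mem_mvPolynomialFunctions (K := K) Finset.univ fun i : Fin d =>
    mul_mem_mvPolynomialFunctions (sub_mem_mvPolynomialFunctions
      (coord_mem_mvPolynomialFunctions i) (const_mem_mvPolynomialFunctions (ha i)))
      (const_mem_mvPolynomialFunctions (hu i))
  convert h using 1
  ext z
  simp [PiLp.inner_apply]

theorem norm_sub_sq_mem_mvPolynomialFunctions {a : EuclideanSpace ℝ (Fin d)}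
    (ha : ∀ i, a i ∈ (algebraMap K ℝ).fieldRange) :
    (fun z => ‖z - a‖ ^ 2) ∈ mvPolynomialFunctions d K := by
  have h := sum_mem_mvPolynomialFunctions (K := K) Finset.univ fun i : Fin d =>
    (mvPolynomialFunctions d K).pow_mem (sub_mem_mvPolynomialFunctions
      (coord_mem_mvPolynomialFunctions i) (const_mem_mvPolynomialFunctions (ha i))) 2
  convert h using 1
  ext z
  simp [EuclideanSpace.real_norm_sq_eq]

/-- The differences from a base point of `d + 1` points spanning `ℝᵈ` are linearly independent. -/
theorem linearIndependent_sub_of_affineSpan_eq_top {a : Fin (d + 1) → EuclideanSpace ℝ (Fin d)}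
    (hspan : affineSpan ℝ (Set.range a) = ⊤) :
    LinearIndependent ℝ fun i : Fin d => a i.succ - a 0 := by
  have hind : AffineIndependent ℝ a := by
    rw [affineIndependent_iff_finrank_vectorSpan_eq ℝ a (n := d) (by simp),
      ← direction_affineSpan, hspan, AffineSubspace.direction_top]
    simp
  have h := (affineIndependent_iff_linearIndependent_vsub ℝ a 0).1 hind
  exact h.comp (fun i : Fin d => (⟨i.succ, i.succ_ne_zero⟩ : {x : Fin (d + 1) // x ≠ 0}))
    fun i j hij => Fin.succ_injective _ (congrArg Subtype.val hij)

/-- A real matrix with entries in `K` whose kernel has no nonzero vector over `K` has an inverse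
with entries in `K`. -/
theorem exists_matrix_inverse {H : Matrix (Fin d) (Fin d) ℝ}
    (hH : ∀ i j, H i j ∈ (algebraMap K ℝ).fieldRange)
    (hker : ∀ c : Fin d → ℝ, (∀ i, c i ∈ (algebraMap K ℝ).fieldRange) →
      H.mulVec c = 0 → c = 0) :
    ∃ M : Matrix (Fin d) (Fin d) ℝ, (∀ i j, M i j ∈ (algebraMap K ℝ).fieldRange) ∧ H * M = 1 := by
  choose HK hHK using hH
  have hmap : (algebraMap K ℝ).mapMatrix (Matrix.of HK) = H := Matrix.ext hHK
  have hdet : (Matrix.of HK).det ≠ 0 := by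
    intro h0
    obtain ⟨c, hc0, hc⟩ := Matrix.exists_mulVec_eq_zero_iff.2 h0
    apply hc0
    have := hker (fun i => algebraMap K ℝ (c i)) (fun i => ⟨c i, rfl⟩) (by
      funext i
      rw [← hmap]
      have := RingHom.map_mulVec (algebraMap K ℝ) (Matrix.of HK) c i
      rw [hc] at this
      rw [Pi.zero_apply, map_zero] at this
      exact this.symm)
    funext i
    exact (algebraMap K ℝ).injective (by simpa using congrFun this i)
  refine ⟨(algebraMap K ℝ).mapMatrix (Matrix.of HK)⁻¹, fun i j => ⟨_, rfl⟩, ?_⟩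
  rw [← hmap, ← map_mul, Matrix.mul_nonsing_inv _ (isUnit_iff_ne_zero.2 hdet), map_one]

/-- Two families of points `a`, `b` have equal distances if they have equal distances to `x` and
to `y`, where `x` is generic over a field containing the coordinates of the `a j` and the
squared distances of the `b j`, and some of the `a j` affinely span `ℝᵈ`. -/
theorem norm_sub_sq_eq_of_generic {J : Type*} {x y : EuclideanSpace ℝ (Fin d)}
    (hx : AlgebraicIndependent K fun i => x i) {a b : J → EuclideanSpace ℝ (Fin d)}
    (ha : ∀ j i, a j i ∈ (algebraMap K ℝ).fieldRange)
    (hb : ∀ i j, ‖b i - b j‖ ^ 2 ∈ (algebraMap K ℝ).fieldRange)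
    (hab : ∀ j, ‖x - a j‖ ^ 2 = ‖y - b j‖ ^ 2) {n : Fin (d + 1) → J}
    (hspan : affineSpan ℝ (Set.range fun i => a (n i)) = ⊤) (i j : J) :
    ‖a i - a j‖ ^ 2 = ‖b i - b j‖ ^ 2 := by
  set k := (algebraMap K ℝ).fieldRange
  let a₀ := a (n 0)
  let b₀ := b (n 0)
  let u : Fin d → EuclideanSpace ℝ (Fin d) := fun i => a (n i.succ) - a₀
  let w : Fin d → EuclideanSpace ℝ (Fin d) := fun i => b (n i.succ) - b₀
  have h2 : (2 : ℝ) ∈ k := ⟨2, map_ofNat _ 2⟩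
  have hu : LinearIndependent ℝ u :=
    linearIndependent_sub_of_affineSpan_eq_top (a := fun i => a (n i)) hspan
  have huk : ∀ i l, u i l ∈ k := fun i l => k.sub_mem (ha _ _) (ha _ _)
  have huu : ∀ i, ‖u i‖ ^ 2 ∈ k := fun i => by
    rw [EuclideanSpace.real_norm_sq_eq]
    exact k.sum_mem fun l _ => k.pow_mem (huk i l) 2
  have hbb : ∀ i j : J, ⟪b i - b₀, b j - b₀⟫ ∈ k := fun i j => by
    rw [inner_sub_sub_eq]
    exact k.div_mem (k.sub_mem (k.add_mem (hb _ _) (hb _ _)) (hb _ _)) h2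
  -- By polarisation, the constant is chosen to make `t i x = ⟪w i, y - b₀⟫`.
  let t : Fin d → EuclideanSpace ℝ (Fin d) → ℝ := fun i z =>
    ⟪u i, z - a₀⟫ + (‖w i‖ ^ 2 - ‖u i‖ ^ 2) / 2
  have htk : ∀ i, (‖w i‖ ^ 2 - ‖u i‖ ^ 2) / 2 ∈ k := fun i =>
    k.div_mem (k.sub_mem (hb _ _) (huu i)) h2
  have htP : ∀ i, t i ∈ mvPolynomialFunctions d K := fun i =>
    add_mem_mvPolynomialFunctions (inner_mem_mvPolynomialFunctions (ha _) (huk i))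
      (const_mem_mvPolynomialFunctions (htk i))
  have htx : ∀ i, ⟪w i, y - b₀⟫ = t i x := fun i => by
    have h1 := inner_sub_sub_eq (a (n i.succ)) x a₀
    have h3 := inner_sub_sub_eq (b (n i.succ)) y b₀
    rw [norm_sub_rev _ x] at h1
    rw [norm_sub_rev _ y, ← hab, ← hab] at h3
    simp only [t, u, w]
    rw [h1, h3]
    ring
  let H : Matrix (Fin d) (Fin d) ℝ := Matrix.gram ℝ w
  have hker : ∀ c : Fin d → ℝ, (∀ i, c i ∈ k) → H.mulVec c = 0 → c = 0 := by
    intro c hc h0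
    have hw : ∑ i, c i • w i = 0 := by
      have h := Matrix.star_dotProduct_gram_mulVec (𝕜 := ℝ) w c c
      rw [show Matrix.gram ℝ w = H from rfl, h0, dotProduct_zero] at h
      exact inner_self_eq_zero.1 h.symm
    have hsum : ∑ i, c i * t i x = 0 := by
      simp only [← htx, ← real_inner_smul_left, ← sum_inner, hw, inner_zero_left]
    have hz := eq_zero_of_mem_mvPolynomialFunctions hx
      (sum_mem_mvPolynomialFunctions Finset.univ fun i => mul_mem_mvPolynomialFunctions
        (const_mem_mvPolynomialFunctions (hc i)) (htP i)) hsum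
    -- The values at `a₀` and `a₀ + ∑ c i • u i` both vanish, and they differ by `‖∑ c i • u i‖ ^
    -- 2`.
    have h1 := hz a₀
    have h3 := hz (∑ i, c i • u i + a₀)
    have h4 : ⟪∑ i, c i • u i, ∑ i, c i • u i⟫ = 0 := by
      rw [sum_inner]
      simp only [t, sub_self, inner_zero_right, zero_add, add_sub_cancel_right, mul_add,
        Finset.sum_add_distrib] at h1 h3
      simp only [real_inner_smul_left]
      linarith
    exact funext (Fintype.linearIndependent_iff.1 hu c (inner_self_eq_zero.1 h4))
  obtain ⟨M, hMk, hHM⟩ := exists_matrix_inverse (K := K) (H := H) (fun i j => hbb _ _) hker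
  have hdet : H.det ≠ 0 := by
    intro h0
    have := congrArg Matrix.det hHM
    rw [Matrix.det_mul, h0, zero_mul, Matrix.det_one] at this
    exact zero_ne_one this
  have hw : LinearIndependent ℝ w := Matrix.linearIndependent_of_det_gram_ne_zero hdet
  -- Since `M` inverts the Gram matrix, these are the coordinates in the basis `w` of the vector
  -- whose inner products with the `w j` are `t j z`.
  let s : Fin d → EuclideanSpace ℝ (Fin d) → ℝ := fun i z => ∑ j, M i j * t j z
  have hsP : ∀ i, s i ∈ mvPolynomialFunctions d K := fun i =>
    sum_mem_mvPolynomialFunctions _ fun j => mul_mem_mvPolynomialFunctions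
      (const_mem_mvPolynomialFunctions (hMk i j)) (htP j)
  let W : EuclideanSpace ℝ (Fin d) → EuclideanSpace ℝ (Fin d) := fun z => ∑ i, s i z • w i
  have hWt : ∀ i z, ⟪w i, W z⟫ = t i z := by
    intro i z
    have h1 : H.mulVec (M.mulVec fun j => t j z) = fun j => t j z := by
      rw [Matrix.mulVec_mulVec, hHM, Matrix.one_mulVec]
    have h3 := congrFun h1 i
    rw [← h3]
    simp only [W, inner_sum, real_inner_smul_right]
    exact Finset.sum_congr rfl fun j _ => mul_comm _ _
  have hWx : W x = y - b₀ := by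
    have hspanw : Submodule.span ℝ (Set.range w) = ⊤ :=
      hw.span_eq_top_of_card_eq_finrank' (by simp)
    refine ext_inner_left ℝ fun v => ?_
    have hv : v ∈ Submodule.span ℝ (Set.range w) := hspanw ▸ Submodule.mem_top
    induction hv using Submodule.span_induction with
    | mem v hv => obtain ⟨i, rfl⟩ := hv; rw [hWt, htx]
    | zero => simp
    | add v v' _ _ h h' => rw [inner_add_left, inner_add_left, h, h']
    | smul c v _ h => rw [real_inner_smul_left, real_inner_smul_left, h]
  have hdist : ∀ (j : J) z, ‖W z + b₀ - b j‖ ^ 2 = ‖z - a j‖ ^ 2 := by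
    intro j z
    have hW : ∀ z, ‖W z + b₀ - b j‖ ^ 2 =
        ∑ i, s i z * t i z - 2 * ∑ i, s i z * ⟪w i, b j - b₀⟫ + ‖b j - b₀‖ ^ 2 := by
      intro z
      rw [show W z + b₀ - b j = W z - (b j - b₀) by abel, norm_sub_sq_real,
        ← real_inner_self_eq_norm_sq (W z)]
      congr 2
      · conv_lhs => rw [show ⟪W z, W z⟫ = ⟪∑ i, s i z • w i, W z⟫ from rfl]
        simp only [sum_inner, real_inner_smul_left, hWt]
      · simp only [W, sum_inner, real_inner_smul_left]
    have hP : (fun z => ‖W z + b₀ - b j‖ ^ 2 - ‖z - a j‖ ^ 2) ∈ mvPolynomialFunctions d K := by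
      simp only [hW]
      refine sub_mem_mvPolynomialFunctions (add_mem_mvPolynomialFunctions
        (sub_mem_mvPolynomialFunctions
          (sum_mem_mvPolynomialFunctions _ fun i => mul_mem_mvPolynomialFunctions (hsP i) (htP i))
          (mul_mem_mvPolynomialFunctions (const_mem_mvPolynomialFunctions h2)
            (sum_mem_mvPolynomialFunctions _ fun i => mul_mem_mvPolynomialFunctions (hsP i)
              (const_mem_mvPolynomialFunctions (hbb _ _)))))
        (const_mem_mvPolynomialFunctions (hb _ _))) (norm_sub_sq_mem_mvPolynomialFunctions (ha j))
    have h0 := eq_zero_of_mem_mvPolynomialFunctions hx hP (by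
      simp only [hWx, sub_add_cancel, hab, sub_self])
    exact sub_eq_zero.1 (h0 z)
  have hi : W (a i) + b₀ = b i := by
    have h := hdist i (a i)
    rw [sub_self, norm_zero, zero_pow two_ne_zero, sq_eq_zero_iff, norm_eq_zero, sub_eq_zero] at h
    exact h
  rw [← hdist j (a i), hi]

end GenericPoint

/-! ### Periodic frameworks: lengths as polynomials and edges of the reduced graph. -/

section PeriodicFrameworks

open MvPolynomial

open scoped IntermediateField.algebraAdjoinAdjoin in
/-- Numbers which are generic over `F` together with `x` are generic over the real algebraic
closure of `F(x)`. -/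
theorem algebraicIndependent_algebraicClosure_adjoin {F ι κ : Type*} [Field F] [Algebra F ℝ]
    {x : ι → ℝ} {y : κ → ℝ} (h : AlgebraicIndependent F (Sum.elim y x)) :
    AlgebraicIndependent (algebraicClosure (IntermediateField.adjoin F (Set.range x)) ℝ) y := by
  -- Independence over `F[x]` passes to its fraction field and then to an algebraic extension.
  have h1 := (AlgebraicIndependent.sumElim_iff.1 h).2
  have h2 : AlgebraicIndependent (IntermediateField.adjoin F (Set.range x)) y := h1.extendScalars _
  exact h2.extendScalars _

variable {Γ V E : Type*} [AddCommGroup Γ] {d : ℕ} {L : Γ →+ EuclideanSpace ℝ (Fin d)}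

theorem apply_mem_latticeField (L : Γ →+ EuclideanSpace ℝ (Fin d)) (γ : Γ) (i : Fin d) :
    L γ i ∈ latticeField L :=
  IntermediateField.subset_adjoin ℚ _ ⟨γ, i, rfl⟩

/-- The squared length of the labelled edge `(u, w, γ)` as a polynomial in the coordinates of the
placement. -/
noncomputable def lengthSqPolynomial (L : Γ →+ EuclideanSpace ℝ (Fin d)) (t : V × V × Γ) :
    MvPolynomial (V × Fin d) (latticeField L) :=
  ∑ i, (X (t.1, i) - (X (t.2.1, i) + C ⟨L t.2.2 i, apply_mem_latticeField L t.2.2 i⟩)) ^ 2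

theorem aeval_lengthSqPolynomial (q : V → EuclideanSpace ℝ (Fin d)) (t : V × V × Γ) :
    aeval (fun s : V × Fin d => q s.1 s.2) (lengthSqPolynomial L t) = completeLengthSq L q t := by
  simp only [lengthSqPolynomial, map_sum, map_pow, map_sub, map_add, aeval_X, aeval_C,
    completeLengthSq, EuclideanSpace.real_norm_sq_eq]
  rfl

/-- If a generic framework is periodically rigid, then for every framework with the same edge
lengths all lengths are algebraic over the coordinates of the generic one. -/
theorem IsPeriodicallyRigid.isAlgebraic_completeLengthSq [Fintype V] {G : LabelledGraph Γ V E}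
    {p q : V → EuclideanSpace ℝ (Fin d)} (hrigid : IsPeriodicallyRigid G L p)
    (hp : IsGenericPlacement L p) (hpq : lengthSq G L p = lengthSq G L q) (t : V × V × Γ) :
    IsAlgebraic (Algebra.adjoin (latticeField L) (Set.range fun s : V × Fin d => p s.1 s.2))
      (completeLengthSq L q t) := by
  rw [← aeval_lengthSqPolynomial]
  refine isAlgebraic_aeval_of_eventually hp
    (S := Set.range fun e => lengthSqPolynomial L (G.src e, G.tgt e, G.label e)) ?_ ?_
  · let Θ : (V × Fin d → ℝ) → V → EuclideanSpace ℝ (Fin d) :=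
      fun z u => WithLp.toLp 2 fun i => z (u, i)
    have hΘ : Continuous Θ := by fun_prop
    have hlim : Filter.Tendsto Θ (𝓝 fun s : V × Fin d => p s.1 s.2) (𝓝 p) :=
      hΘ.tendsto fun s : V × Fin d => p s.1 s.2
    filter_upwards [hlim.eventually hrigid] with z hz hS
    have hval : ∀ t : V × V × Γ, aeval z (lengthSqPolynomial L t) = completeLengthSq L (Θ z) t :=
      fun t => aeval_lengthSqPolynomial (Θ z) t
    rw [hval, aeval_lengthSqPolynomial]
    refine (congrFun (hz (funext fun e => ?_)) t).symm
    have := hS _ ⟨e, rfl⟩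
    rw [hval, aeval_lengthSqPolynomial] at this
    exact this.symm
  · rintro _ ⟨e, rfl⟩
    rw [aeval_lengthSqPolynomial, aeval_lengthSqPolynomial]
    exact (congrFun hpq e).symm

theorem completeLengthSq_symm (p : V → EuclideanSpace ℝ (Fin d)) (u w : V) (γ : Γ) :
    completeLengthSq L p (u, w, γ) = completeLengthSq L p (w, u, -γ) := by
  simp only [completeLengthSq, map_neg]
  rw [norm_sub_rev]
  congr 2
  abel

/-- Only the relative translation matters, by periodicity. The label `-x.1 + y.1` is the one that
`G_v` gives to the edge joining two neighbours of `v`. -/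
theorem norm_coveringPlacement_sub_sq (p : V → EuclideanSpace ℝ (Fin d)) (x y : Γ × V) :
    ‖coveringPlacement L p x - coveringPlacement L p y‖ ^ 2 =
      completeLengthSq L p (x.2, y.2, -x.1 + y.1) := by
  simp only [completeLengthSq, coveringPlacement, map_add, map_neg]
  congr 2
  abel

theorem completeLengthSq_eq_of_hasEdge {G : LabelledGraph Γ V E}
    {p q : V → EuclideanSpace ℝ (Fin d)} (hpq : lengthSq G L p = lengthSq G L q) {u w : V} {γ : Γ}
    (h : G.HasEdge u w γ) : completeLengthSq L p (u, w, γ) = completeLengthSq L q (u, w, γ) := by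
  obtain ⟨e, ⟨rfl, rfl, rfl⟩ | ⟨rfl, rfl, rfl⟩⟩ := h
  · exact congrFun hpq e
  · rw [completeLengthSq_symm, completeLengthSq_symm q, neg_neg]
    exact congrFun hpq e

theorem LabelledGraph.hasEdge_of_covering_adj {G : LabelledGraph Γ V E} {v : V} {x : Γ × V}
    (h : G.covering.Adj (0, v) x) : G.HasEdge v x.2 x.1 := by
  obtain ⟨e, γ, ⟨h1, rfl⟩ | ⟨rfl, h2⟩⟩ := h
  · simp only [Prod.mk.injEq] at h1
    exact ⟨e, Or.inl ⟨h1.2.symm, rfl, by rw [← h1.1, add_zero]⟩⟩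
  · simp only [Prod.mk.injEq] at h2
    exact ⟨e, Or.inr ⟨h2.2.symm, rfl, neg_eq_of_add_eq_zero_right h2.1.symm⟩⟩

/-- If all neighbours of `v` keep their distances, then so do the edges of `G_v`. -/
theorem lengthSq_reduce_eq {G : LabelledGraph Γ V E} {v : V} {p q : V → EuclideanSpace ℝ (Fin d)}
    (hpq : lengthSq G L p = lengthSq G L q)
    (h : ∀ x y : Γ × V, G.HasEdge v x.2 x.1 → G.HasEdge v y.2 y.1 →
      ‖coveringPlacement L p x - coveringPlacement L p y‖ ^ 2 =
        ‖coveringPlacement L q x - coveringPlacement L q y‖ ^ 2) :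
    lengthSq (G.reduce v) L (fun u => p u.1) = lengthSq (G.reduce v) L (fun u => q u.1) := by
  funext e
  have he : (G.reduce v).HasEdge _ _ _ := ⟨e, Or.inl ⟨rfl, rfl, rfl⟩⟩
  rw [LabelledGraph.hasEdge_reduce] at he
  rcases he with he | ⟨-, α, β, hα, hβ, hlabel⟩
  · exact completeLengthSq_eq_of_hasEdge hpq he
  · have := h (α, _) (β, _) hα hβ
    rw [norm_coveringPlacement_sub_sq, norm_coveringPlacement_sub_sq, ← hlabel] at this
    exact this

end PeriodicFrameworks

/-! ### The vertex removal lemma. -/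

theorem mainTheorem3 {Γ V E : Type*} [AddCommGroup Γ] [Fintype V] (d k : ℕ)
    (hk : 0 < k) (hkd : k ≤ d) (hΓ : Nonempty (Γ ≃+ (Fin k → ℤ)))
    (L : Γ →+ EuclideanSpace ℝ (Fin d)) (hL : IsNonsingular k L)
    (G : LabelledGraph Γ V E) (p : V → EuclideanSpace ℝ (Fin d))
    (hp : IsGenericPlacement L p) (hcard : d - k + 1 ≤ Fintype.card V)
    (v : V)
    (hspan : ∃ n : Fin (d + 1) → Γ × V, (∀ i, G.covering.Adj (0, v) (n i)) ∧
      affineSpan ℝ (Set.range fun i => coveringPlacement L p (n i)) = ⊤)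
    (hrigid : IsPeriodicallyRigid (G.deleteVertex v) L (fun u => p u.1))
    (hglobal : IsPeriodicallyGloballyRigid (G.reduce v) L (fun u => p u.1)) :
    IsPeriodicallyGloballyRigid G L p := by
  classical
  intro q hpq
  obtain ⟨n, hn, hspan⟩ := hspan
  have hn' : ∀ i, G.HasEdge v (n i).2 (n i).1 := fun i =>
    LabelledGraph.hasEdge_of_covering_adj (hn i)
  let p' : {u : V // u ≠ v} × Fin d → ℝ := fun s => p s.1.1 s.2
  have hp' : IsGenericPlacement L fun u : {u : V // u ≠ v} => p u.1 :=
    hp.comp (fun s : {u : V // u ≠ v} × Fin d => (s.1.1, s.2)) fun s t h => by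
      simp only [Prod.mk.injEq] at h
      exact Prod.ext (Subtype.ext h.1) h.2
  let K₀ := IntermediateField.adjoin (latticeField L) (Set.range p')
  let K := algebraicClosure K₀ ℝ
  have hx : AlgebraicIndependent K fun i => p v i := by
    refine algebraicIndependent_algebraicClosure_adjoin ?_
    have hinj : Function.Injective (Sum.elim (fun i : Fin d => (v, i))
        fun s : {u : V // u ≠ v} × Fin d => (s.1.1, s.2)) := by
      rintro (i | ⟨⟨u, hu⟩, i⟩) (j | ⟨⟨w, hw⟩, j⟩) h <;>
        simp only [Sum.elim_inl, Sum.elim_inr, Prod.mk.injEq] at h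
      · rw [h.2]
      · exact absurd h.1.symm hw
      · exact absurd h.1 hu
      · obtain ⟨rfl, rfl⟩ := h
        rfl
    convert hp.comp _ hinj using 1
    ext (i | s) <;> rfl
  have hK₀ : ∀ r ∈ K₀, r ∈ (algebraMap K ℝ).fieldRange := fun r hr =>
    ⟨⟨r, (isAlgebraic_algebraMap (⟨r, hr⟩ : K₀)).isIntegral⟩, rfl⟩
  have hK : ∀ t, completeLengthSq L (fun u : {u : V // u ≠ v} => q u.1) t ∈
      (algebraMap K ℝ).fieldRange := by
    intro t
    have halg : IsAlgebraic (Algebra.adjoin (latticeField L) (Set.range p')) _ :=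
      hrigid.isAlgebraic_completeLengthSq hp'
        (q := fun u : {u : V // u ≠ v} => q u.1) (funext fun e => congrFun hpq e.1) t
    open scoped IntermediateField.algebraAdjoinAdjoin in
    have halg' : IsAlgebraic K₀ _ := halg.extendScalars (S := K₀)
      (FaithfulSMul.algebraMap_injective _ _)
    exact ⟨⟨_, halg'.isIntegral⟩, rfl⟩
  have hneigh : ∀ x y : Γ × V, G.HasEdge v x.2 x.1 → G.HasEdge v y.2 y.1 →
      ‖coveringPlacement L p x - coveringPlacement L p y‖ ^ 2 =
        ‖coveringPlacement L q x - coveringPlacement L q y‖ ^ 2 := by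
    intro x y hx' hy'
    -- The family consists of all neighbours of `v` in the covering, not just the spanning `d + 1`,
    -- since every new edge of `G_v` must keep its length.
    refine norm_sub_sq_eq_of_generic (J := {x : Γ × V // G.HasEdge v x.2 x.1}) (y := q v) hx
      (a := fun j => coveringPlacement L p j.1) (b := fun j => coveringPlacement L q j.1)
      (n := fun i => ⟨n i, hn' i⟩) ?_ ?_ ?_ hspan ⟨x, hx'⟩ ⟨y, hy'⟩
    · intro j i
      refine hK₀ _ (K₀.add_mem ?_ ?_)
      · exact IntermediateField.subset_adjoin _ _ ⟨(⟨j.1.2, j.2.ne.symm⟩, i), rfl⟩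
      · exact K₀.algebraMap_mem ⟨L j.1.1 i, apply_mem_latticeField L j.1.1 i⟩
    · intro i j
      rw [norm_coveringPlacement_sub_sq]
      exact hK (⟨i.1.2, i.2.ne.symm⟩, ⟨j.1.2, j.2.ne.symm⟩, -i.1.1 + j.1.1)
    · intro j
      exact completeLengthSq_eq_of_hasEdge hpq j.2
  have hrest := hglobal (fun u => q u.1) (lengthSq_reduce_eq hpq hneigh)
  have hne : ∀ (u w : V) (γ : Γ), u ≠ v → w ≠ v →
      completeLengthSq L p (u, w, γ) = completeLengthSq L q (u, w, γ) :=
    fun u w γ hu hw => congrFun hrest (⟨u, hu⟩, ⟨w, hw⟩, γ)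
  have hv : ∀ (w : V) (γ : Γ), w ≠ v →
      completeLengthSq L p (v, w, γ) = completeLengthSq L q (v, w, γ) := by
    intro w γ hw
    refine norm_sub_sq_eq_of_affineSpan_eq_top hspan 0 (x := p v) (y := q v)
      (b := fun i => coveringPlacement L q (n i)) (x' := coveringPlacement L p (γ, w))
      (y' := coveringPlacement L q (γ, w)) (fun i j => hneigh _ _ (hn' i) (hn' j))
      (fun i => completeLengthSq_eq_of_hasEdge hpq (hn' i)) fun i => ?_
    rw [norm_coveringPlacement_sub_sq, norm_coveringPlacement_sub_sq]
    exact hne _ _ _ hw (hn' i).ne.symm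
  funext ⟨u, w, γ⟩
  by_cases hu : u = v <;> by_cases hw : w = v
  -- From `v` to its own translate the displacement is `-L γ`, whatever the placement.
  · subst hu hw
    simp [completeLengthSq]
  · subst hu
    exact hv w γ hw
  · subst hw
    rw [completeLengthSq_symm, completeLengthSq_symm q]
    exact hv u _ hu
  · exact hne u w γ hu hw
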